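/- Consider a regular system of ordinary differential equations \[ u_i'=f_i(t,u_1,\dots,u_n),\qquad 1\le i\le n, \] where each $f_i$ is a polynomial in $u_1,\dots,u_n$ whose coefficients are analytic functions of $t$ on an open set $T\subseteq\mathbb{C}$. A \emph{balance} of the system is a family of formal Laurent series solutions with movable singularity $t_0$, \[ u_i=\sum_{j\ge 0}a_{i,j}(t_0,r_2,\dots,r_{q+1})\,(t-t_0)^{j-k_i},\qquad 1\le i\le n, \] where $k_i\in\mathbb{Z}$, the $a_{i,j}$ are analytic on a common non-empty open set $\Omega\subseteq\mathbb{C}\times\mathbb{C}^{q}$ of parameter values $(t_0,r)$ with $t_0\in T$, and, for every $(t_0,r)\in\Omega$, the series satisfy the system formally (the coefficients of $f_i$ being expanded in Taylor series at $t_0$). Each parameter $r_m$ has a resonance $\lambda(m)\in\{0,1,2,\dots\}$, with $\lambda(2)\le\dots\le\lambda(q+1)$, and $a_{i,j}$ depends only on $t_0$ and on those $r_m$ with $\lambda(m)\le j$. The \emph{resonance matrix} of the balance is the $n\times(q+1)$ matrix $R(t_0,r)$ whose first column is $(-k_ia_{i,0})_{i}$ and whose column belonging to $r_m$ is $\bigl(\partial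 a_{i,\lambda(m)}/\partial r_m\bigr)_{i}$. The balance is \emph{principal} if $q+1=n$ and $R(t_0,r)$ is invertible for all $(t_0,r)\in\Omega$. The system \emph{passes the Painlevé test} if it has a principal balance. \textbf{Corollary (convergence of Laurent series).} If a regular system of ordinary differential equations passes the Painlevé test, then the Laurent series solutions obtained from the test always converge: for every principal balance and every $(t_0,r)\in\Omega$ there is $\varepsilon>0$ such that all the series $\sum_{j\ge0}a_{i,j}(t_0,r)(t-t_0)^{j-k_i}$, $1\le i\le n$, converge for $0<|t-t_0|<\varepsilon$. -/

import Mathlib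

noncomputable section

/-- A regular system of ordinary differential equations `uᵢ' = fᵢ(t, u₁, …, uₙ)`, `1 ≤ i ≤ n`,
whose right sides are analytic in `t` (on an open set `T ⊆ ℂ`) and polynomial in `u₁, …, uₙ`:
`fᵢ` is a polynomial in `n` indeterminates whose coefficients are functions of `t`, analytic
on `T`. -/
structure RegularODE (n : ℕ) where
  /-- the domain of the independent variable -/
  T : Set ℂ
  isOpen_T : IsOpen T
  /-- the right sides -/
  f : Fin n → MvPolynomial (Fin n) (ℂ → ℂ)
  analytic_coeff : ∀ (i : Fin n) (m : Fin n →₀ ℕ), AnalyticOnNhd ℂ ((f i).coeff m) T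

/-- The Taylor series `∑ₖ c⁽ᵏ⁾(t₀) / k! · zᵏ` of `c` at `t₀`, in the local variable
`z = t - t₀`, seen as a formal Laurent series. -/
def taylorLaurent (c : ℂ → ℂ) (t₀ : ℂ) : LaurentSeries ℂ :=
  HahnSeries.ofPowerSeries ℤ ℂ
    (PowerSeries.mk fun k => iteratedDeriv k c t₀ / (k.factorial : ℂ))

/-- The result `P(t₀ + z, U₁(z), …, Uₙ(z))` of substituting `t = t₀ + z` and the formal Laurent
series `U₁, …, Uₙ` in `z` into a polynomial `P` in `u₁, …, uₙ` with coefficients functions of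
`t`. -/
def substLaurent {n : ℕ} (P : MvPolynomial (Fin n) (ℂ → ℂ)) (t₀ : ℂ)
    (U : Fin n → LaurentSeries ℂ) : LaurentSeries ℂ :=
  ∑ m ∈ P.support, taylorLaurent (P.coeff m) t₀ * ∏ j : Fin n, U j ^ m j

/-- The formal Laurent series `∑_{j ≥ 0} aⱼ z^(j - k)`. -/
def laurentOf (k : ℤ) (a : ℕ → ℂ) : LaurentSeries ℂ :=
  HahnSeries.single (-k) (1 : ℂ) * HahnSeries.ofPowerSeries ℤ ℂ (PowerSeries.mk a)

/-- `U₁, …, Uₙ`, formal Laurent series in `z = t - t₀`, form a formal solution of the system. -/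
def RegularODE.IsFormalSolution {n : ℕ} (S : RegularODE n) (t₀ : ℂ)
    (U : Fin n → LaurentSeries ℂ) : Prop :=
  ∀ i, LaurentSeries.derivative ℂ (U i) = substLaurent (S.f i) t₀ U

/-- A balance of the system: a family of formal Laurent series solutions
`uᵢ = ∑_{j ≥ 0} a_{i,j}(t₀, r) (t - t₀)^(j - kᵢ)` with movable singularity `t₀`, where `r` stands
for the `q` resonance parameters other than `t₀`. The leading coefficients `a_{i,0}` are allowed to
vanish. Listing, for every parameter `r_m`, its resonance `res m` is the same as giving the
resonances `λ₁ < ⋯ < λₛ` (the distinct values of `res`) together with their multiplicities. -/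
structure Balance {n : ℕ} (S : RegularODE n) where
  /-- the leading exponents: the series of `uᵢ` starts with `(t - t₀)^(-kᵢ)` -/
  k : Fin n → ℤ
  /-- the number of resonance parameters other than `t₀` -/
  q : ℕ
  /-- the resonances of these parameters, in increasing order -/
  res : Fin q → ℕ
  monotone_res : Monotone res
  /-- the domain of the parameters `(t₀, r)` -/
  Ω : Set (ℂ × (Fin q → ℂ))
  isOpen_Ω : IsOpen Ω
  nonempty_Ω : Ω.Nonempty
  mem_T : ∀ p ∈ Ω, p.1 ∈ S.T
  /-- the coefficients -/
  a : Fin n → ℕ → ℂ × (Fin q → ℂ) → ℂ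
  analytic_a : ∀ i j, AnalyticOnNhd ℂ (a i j) Ω
  /-- `a_{i,j}` depends only on `t₀` and on the parameters of resonance at most `j` -/
  depends : ∀ i j, ∀ p ∈ Ω, ∀ p' ∈ Ω, p.1 = p'.1 →
    (∀ m, res m ≤ j → p.2 m = p'.2 m) → a i j p = a i j p'
  /-- for all values of the parameters the series formally solve the system -/
  solution : ∀ p ∈ Ω, S.IsFormalSolution p.1 fun i => laurentOf (k i) fun j => a i j p

namespace Balance

variable {n : ℕ} {S : RegularODE n}

/-- The resonance matrix. Its first column is the basic resonance vector `(-kᵢ a_{i,0})ᵢ`; the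
column that belongs to the parameter `r_m`, of resonance `λ`, is `(∂a_{i,λ} / ∂r_m)ᵢ`. -/
def resonanceMatrix (B : Balance S) (p : ℂ × (Fin B.q → ℂ)) :
    Matrix (Fin n) (Fin (B.q + 1)) ℂ :=
  Matrix.of fun i => Fin.cons (-(B.k i : ℂ) * B.a i 0 p)
    fun m => fderiv ℂ (B.a i (B.res m)) p (0, Pi.single m 1)

/-- A balance is principal if it has `n` free parameters, `t₀` included, and its resonance matrix
is invertible. -/
def IsPrincipal (B : Balance S) : Prop :=
  ∃ h : B.q + 1 = n, ∀ p ∈ B.Ω,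
    IsUnit ((B.resonanceMatrix p).submatrix id (Fin.cast h.symm))

/-- For the parameter values `p = (t₀, r)`, the Laurent series of the balance converge in a
punctured disc around `t₀`. -/
def ConvergesAt (B : Balance S) (p : ℂ × (Fin B.q → ℂ)) : Prop :=
  ∃ ε > 0, ∀ t : ℂ, 0 < ‖t - p.1‖ → ‖t - p.1‖ < ε →
    ∀ i, Summable fun j : ℕ => B.a i j p * (t - p.1) ^ ((j : ℤ) - B.k i)

end Balance

/-- The system passes the Painlevé test: it has a principal balance. -/
def RegularODE.PassesPainleveTest {n : ℕ} (S : RegularODE n) : Prop :=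
  ∃ B : Balance S, B.IsPrincipal

end

/-!
The convergence of the series of a principal balance is a property of each single member of the
family, once the family has been used to show that the linearized system is regular singular.

Differentiating a family of formal solutions `U` with respect to a parameter, at constant `t`, gives
a formal solution of the linearized system `V' = A V`, where `A = ∂f/∂u (t, U)`. The derivatives
with respect to `t₀` and the `r_m` have the leading terms `z^(-kᵢ + μ) R_{i,m}`, where `z = t - t₀`,
`R` is the resonance matrix and `μ` is `-1` or the resonance (up to sign in the first column). If
the balance is principal, they form a fundamental matrix `z^(-K) M(z) z^μ` with `M` a matrix of
power series and `M(0) = R` invertible, so `z^K A z^(-K)` has at most a simple pole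
(`Balance.IsPrincipal.exists_simple_pole`).

In the variables `wᵢ = z^(kᵢ) uᵢ`, which are power series, the system reads `z^c θw = F(z, w)` with
`θ = z d/dz`, where `F` is polynomial in `w` with convergent coefficients, and the simple pole means
that `z^c` divides `∂F/∂w` along the solution. Write `w = b + z^N v` with `b` a truncation of `w`.
For large `N` the nonlinear terms acquire a factor `z` after division by `z^(N + c)`, and the
equation becomes `θv + N v = h + β v + z E(z, v)` with convergent `h`, `β`, `E` and with `β(0)`
independent of `N` (`isConvergent_of_regular_linearization`). Choosing `N` larger than the size of
`β(0)`, the partial sums `∑_{j < J} |v_j| ρ^j` are bounded by induction on `J` for small `ρ`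
(`isConvergent_of_large_shift`).
-/

open PowerSeries Finset Filter Topology

/-! ### Convergent power series -/

/-- The partial sum `∑_{j < J} |φⱼ| ρʲ` of the majorant series of a power series `φ`. -/
noncomputable def partialNorm (ρ : ℝ) (J : ℕ) (φ : PowerSeries ℂ) : ℝ :=
  ∑ j ∈ range J, ‖coeff j φ‖ * ρ ^ j

lemma partialNorm_nonneg {ρ : ℝ} (hρ : 0 ≤ ρ) (J : ℕ) (φ : PowerSeries ℂ) :
    0 ≤ partialNorm ρ J φ :=
  sum_nonneg fun _ _ => by positivity

lemma partialNorm_add_le {ρ : ℝ} (hρ : 0 ≤ ρ) (J : ℕ) (φ ψ : PowerSeries ℂ) :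
    partialNorm ρ J (φ + ψ) ≤ partialNorm ρ J φ + partialNorm ρ J ψ := by
  unfold partialNorm
  rw [← sum_add_distrib]
  refine sum_le_sum fun j _ => ?_
  rw [← add_mul, map_add]
  gcongr
  exact norm_add_le _ _

lemma partialNorm_sum_le {ι : Type*} {ρ : ℝ} (hρ : 0 ≤ ρ) (J : ℕ) (s : Finset ι)
    (φ : ι → PowerSeries ℂ) :
    partialNorm ρ J (∑ i ∈ s, φ i) ≤ ∑ i ∈ s, partialNorm ρ J (φ i) :=
  le_sum_of_subadditive (partialNorm ρ J) (by simp [partialNorm])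
    (partialNorm_add_le hρ J) s φ

lemma partialNorm_mul_le {ρ : ℝ} (hρ : 0 ≤ ρ) (J : ℕ) (φ ψ : PowerSeries ℂ) :
    partialNorm ρ J (φ * ψ) ≤ partialNorm ρ J φ * partialNorm ρ J ψ := by
  have h1 : partialNorm ρ J (φ * ψ) ≤ ∑ j ∈ range J, ∑ q ∈ antidiagonal j,
      (‖coeff q.1 φ‖ * ρ ^ q.1) * (‖coeff q.2 ψ‖ * ρ ^ q.2) := by
    refine sum_le_sum fun j _ => ?_
    rw [coeff_mul]
    calc _ ≤ (∑ q ∈ antidiagonal j, ‖coeff q.1 φ * coeff q.2 ψ‖) * ρ ^ j := by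
          gcongr
          exact norm_sum_le _ _
      _ = _ := by
          rw [sum_mul]
          refine sum_congr rfl fun q hq => ?_
          rw [← HasAntidiagonal.mem_antidiagonal.1 hq, norm_mul, pow_add]
          ring
  refine h1.trans ?_
  unfold partialNorm
  have hinj : Set.InjOn (fun x : (_ : ℕ) × (ℕ × ℕ) => x.2)
      ((range J).sigma fun j => antidiagonal j) := by
    rintro ⟨j, a⟩ hx ⟨j', a'⟩ hx' h
    simp only [coe_sigma, Set.mem_sigma_iff, mem_coe, HasAntidiagonal.mem_antidiagonal] at hx hx'
    obtain rfl : a = a' := h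
    obtain rfl : j = j' := hx.2.symm.trans hx'.2
    rfl
  rw [sum_mul_sum, ← sum_product', sum_sigma', ← sum_image
    (f := fun q : ℕ × ℕ => (‖coeff q.1 φ‖ * ρ ^ q.1) * (‖coeff q.2 ψ‖ * ρ ^ q.2)) hinj]
  refine sum_le_sum_of_subset_of_nonneg ?_ fun _ _ _ => by positivity
  rintro q hq
  obtain ⟨x, hx, rfl⟩ := mem_image.1 hq
  simp only [mem_sigma, mem_range, HasAntidiagonal.mem_antidiagonal, mem_product] at hx ⊢
  omega

lemma partialNorm_X_mul (ρ : ℝ) (J : ℕ) (φ : PowerSeries ℂ) :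
    partialNorm ρ (J + 1) (X * φ) = ρ * partialNorm ρ J φ := by
  unfold partialNorm
  rw [sum_range_succ', mul_sum]
  simp only [coeff_succ_X_mul, coeff_zero_X_mul, norm_zero, zero_mul, add_zero]
  exact sum_congr rfl fun j _ => by ring

lemma partialNorm_C_le {ρ : ℝ} (J : ℕ) (a : ℂ) :
    partialNorm ρ J (C a) ≤ ‖a‖ := by
  unfold partialNorm
  cases J with
  | zero => simp
  | succ J => rw [sum_range_succ']; simp [coeff_C]

lemma partialNorm_mono_radius {ρ ρ' : ℝ} (hρ : 0 ≤ ρ) (h : ρ ≤ ρ') (J : ℕ) (φ : PowerSeries ℂ) :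
    partialNorm ρ J φ ≤ partialNorm ρ' J φ := by
  unfold partialNorm
  gcongr

lemma partialNorm_mono_length {ρ : ℝ} (hρ : 0 ≤ ρ) {J J' : ℕ} (h : J ≤ J') (φ : PowerSeries ℂ) :
    partialNorm ρ J φ ≤ partialNorm ρ J' φ :=
  sum_le_sum_of_subset_of_nonneg (range_mono h) fun _ _ _ => by positivity

/-- A power series converges if its majorant series has bounded partial sums for some positive
radius. -/
def IsConvergent (φ : PowerSeries ℂ) : Prop :=
  ∃ ρ > 0, ∃ K, ∀ J, partialNorm ρ J φ ≤ K

/-- A convergent series is bounded uniformly on all small radii. -/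
lemma IsConvergent.eventually {φ : PowerSeries ℂ} (h : IsConvergent φ) :
    ∃ K, ∀ᶠ ρ in 𝓝[>] (0 : ℝ), ∀ J, partialNorm ρ J φ ≤ K := by
  obtain ⟨ρ, hρ, K, hK⟩ := h
  refine ⟨K, ?_⟩
  filter_upwards [Ioc_mem_nhdsGT hρ] with ρ' hρ' J
  exact (partialNorm_mono_radius hρ'.1.le hρ'.2 J φ).trans (hK J)

lemma isConvergent_of_eventually {φ : PowerSeries ℂ} {K : ℝ}
    (h : ∀ᶠ ρ in 𝓝[>] (0 : ℝ), ∀ J, partialNorm ρ J φ ≤ K) : IsConvergent φ := by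
  obtain ⟨ρ, h1, h2⟩ := (h.and self_mem_nhdsWithin).exists
  exact ⟨ρ, h2, K, h1⟩

lemma IsConvergent.of_X_mul {φ : PowerSeries ℂ} (h : IsConvergent (X * φ)) : IsConvergent φ := by
  obtain ⟨ρ, hρ, K, hK⟩ := h
  refine ⟨ρ, hρ, K / ρ, fun J => ?_⟩
  rw [le_div_iff₀ hρ, mul_comm, ← partialNorm_X_mul]
  exact hK _

lemma IsConvergent.of_X_pow_mul {φ : PowerSeries ℂ} (m : ℕ) (h : IsConvergent (X ^ m * φ)) :
    IsConvergent φ := by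
  induction m with
  | zero => simpa using h
  | succ m ih => exact ih (.of_X_mul (by rwa [← mul_assoc, ← pow_succ']))

lemma IsConvergent.summable {φ : PowerSeries ℂ} (h : IsConvergent φ) :
    ∀ᶠ ρ in 𝓝[>] (0 : ℝ), Summable fun j => ‖coeff j φ‖ * ρ ^ j := by
  obtain ⟨K, hK⟩ := h.eventually
  filter_upwards [hK, self_mem_nhdsWithin] with ρ h1 (h2 : 0 < ρ)
  exact summable_of_sum_range_le (fun _ => by positivity) h1

/-- The algebra of convergent power series. -/
def convergentSeries : Subalgebra ℂ (PowerSeries ℂ) where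
  carrier := {φ | IsConvergent φ}
  mul_mem' {φ ψ} h h' := by
    obtain ⟨K, hK⟩ := h.eventually
    obtain ⟨K', hK'⟩ := h'.eventually
    refine isConvergent_of_eventually (K := K * K') ?_
    filter_upwards [hK, hK', self_mem_nhdsWithin] with ρ h1 h2 (h3 : 0 < ρ) J
    exact (partialNorm_mul_le h3.le J φ ψ).trans (mul_le_mul (h1 J) (h2 J)
      (partialNorm_nonneg h3.le _ _) ((partialNorm_nonneg h3.le _ _).trans (h1 J)))
  add_mem' {φ ψ} h h' := by
    obtain ⟨K, hK⟩ := h.eventually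
    obtain ⟨K', hK'⟩ := h'.eventually
    refine isConvergent_of_eventually (K := K + K') ?_
    filter_upwards [hK, hK', self_mem_nhdsWithin] with ρ h1 h2 (h3 : 0 < ρ) J
    exact (partialNorm_add_le h3.le J φ ψ).trans (add_le_add (h1 J) (h2 J))
  algebraMap_mem' a := ⟨1, one_pos, ‖a‖, fun J => partialNorm_C_le J a⟩

lemma mem_convergentSeries {φ : PowerSeries ℂ} : φ ∈ convergentSeries ↔ IsConvergent φ := Iff.rfl

lemma X_mem_convergentSeries : (X : PowerSeries ℂ) ∈ convergentSeries := by
  refine ⟨1, one_pos, 1, fun J => ?_⟩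
  cases J with
  | zero => simp [partialNorm]
  | succ J =>
    rw [← mul_one (X : PowerSeries ℂ), partialNorm_X_mul, one_mul, ← map_one C]
    simpa using partialNorm_C_le J (1 : ℂ)

lemma polynomial_mem_convergentSeries (P : Polynomial ℂ) :
    (P : PowerSeries ℂ) ∈ convergentSeries := by
  induction P using Polynomial.induction_on' with
  | add p q hp hq => rw [Polynomial.coe_add]; exact add_mem hp hq
  | monomial m a =>
    rw [← Polynomial.C_mul_X_pow_eq_monomial, Polynomial.coe_mul, Polynomial.coe_C,
      Polynomial.coe_pow, Polynomial.coe_X]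
    exact mul_mem (convergentSeries.algebraMap_mem a) (pow_mem X_mem_convergentSeries m)

/-- On small discs a convergent series is bounded by any number exceeding the norm of its constant
term. -/
lemma IsConvergent.eventually_le {φ : PowerSeries ℂ} (h : IsConvergent φ) {K : ℝ}
    (hK : ‖constantCoeff φ‖ < K) : ∀ᶠ ρ in 𝓝[>] (0 : ℝ), ∀ J, partialNorm ρ J φ ≤ K := by
  obtain ⟨ψ, hψ⟩ : X ∣ φ - C (constantCoeff φ) := X_dvd_iff.2 (by simp)
  have hφ : φ = C (constantCoeff φ) + X * ψ := by rw [← hψ]; ring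
  have hc : IsConvergent ψ := by
    refine .of_X_mul (hψ ▸ ?_)
    exact sub_mem (show φ ∈ convergentSeries from h) (convergentSeries.algebraMap_mem _)
  obtain ⟨K', hK'⟩ := hc.eventually
  have hsmall : ∀ᶠ ρ in 𝓝[>] (0 : ℝ), ‖constantCoeff φ‖ + ρ * K' < K := by
    have : Tendsto (fun ρ : ℝ => ‖constantCoeff φ‖ + ρ * K') (𝓝 0)
        (𝓝 (‖constantCoeff φ‖ + 0 * K')) := by
      apply Continuous.tendsto
      fun_prop
    rw [zero_mul, add_zero] at this
    exact (this.mono_left nhdsWithin_le_nhds).eventually_lt_const hK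
  filter_upwards [hK', hsmall, self_mem_nhdsWithin] with ρ h1 h2 (h3 : 0 < ρ) J
  refine (partialNorm_mono_length h3.le J.le_succ φ).trans ?_
  rw [hφ]
  refine (partialNorm_add_le h3.le _ _ _).trans (le_trans ?_ h2.le)
  refine add_le_add (by simpa using partialNorm_C_le _ _) ?_
  rw [partialNorm_X_mul]
  exact mul_le_mul_of_nonneg_left (h1 J) h3.le

/-- A polynomial with convergent coefficients is bounded on bounded sets, uniformly in the
truncation order `J` and for all small radii. -/
lemma exists_partialNorm_aeval_le {σ : Type*} (E : MvPolynomial σ convergentSeries) (M : ℝ) :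
    ∃ K, ∀ᶠ ρ in 𝓝[>] (0 : ℝ), ∀ (J : ℕ) (v : σ → PowerSeries ℂ),
      (∀ i, partialNorm ρ J (v i) ≤ M) → partialNorm ρ J (MvPolynomial.aeval v E) ≤ K := by
  induction E using MvPolynomial.induction_on with
  | C a =>
    obtain ⟨K, hK⟩ := (mem_convergentSeries.1 a.2).eventually
    refine ⟨K, hK.mono fun ρ h J v _ => ?_⟩
    rw [MvPolynomial.aeval_C]
    exact h J
  | add p q hp hq =>
    obtain ⟨K, hK⟩ := hp
    obtain ⟨K', hK'⟩ := hq
    refine ⟨K + K', ?_⟩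
    filter_upwards [hK, hK', self_mem_nhdsWithin] with ρ h1 h2 (h3 : 0 < ρ) J v hv
    rw [map_add]
    exact (partialNorm_add_le h3.le J _ _).trans (add_le_add (h1 J v hv) (h2 J v hv))
  | mul_X p i hp =>
    obtain ⟨K, hK⟩ := hp
    refine ⟨K * M, ?_⟩
    filter_upwards [hK, self_mem_nhdsWithin] with ρ h1 (h3 : 0 < ρ) J v hv
    rw [map_mul, MvPolynomial.aeval_X]
    exact (partialNorm_mul_le h3.le J _ _).trans (mul_le_mul (h1 J v hv) (hv i)
      (partialNorm_nonneg h3.le _ _) ((partialNorm_nonneg h3.le _ _).trans (h1 J v hv)))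

/-- The Taylor series of an analytic function converges. -/
lemma isConvergent_taylor {c : ℂ → ℂ} {t₀ : ℂ} (h : AnalyticAt ℂ c t₀) :
    IsConvergent (PowerSeries.mk fun k => iteratedDeriv k c t₀ / (k.factorial : ℂ)) := by
  have hp := h.hasFPowerSeriesAt
  obtain ⟨r, h0, hr⟩ := ENNReal.lt_iff_exists_nnreal_btwn.1 hp.radius_pos
  have hs := FormalMultilinearSeries.summable_norm_mul_pow _ hr
  refine ⟨r, by exact_mod_cast h0, ∑' j, ‖FormalMultilinearSeries.ofScalars ℂ
    (fun k => iteratedDeriv k c t₀ / (k.factorial : ℂ)) j‖ * (r : ℝ) ^ j, fun J => ?_⟩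
  refine le_trans (le_of_eq ?_) (hs.sum_le_tsum (range J) fun _ _ => by positivity)
  refine sum_congr rfl fun j _ => ?_
  rw [coeff_mk, FormalMultilinearSeries.ofScalars_norm]

/-! ### Convergence of formal solutions of Briot–Bouquet systems -/

/-- The Euler operator `φ ↦ X φ'` on power series. -/
noncomputable def eulerD : Derivation ℂ (PowerSeries ℂ) (PowerSeries ℂ) :=
  (X : PowerSeries ℂ) • PowerSeries.derivative ℂ

lemma coeff_eulerD (φ : PowerSeries ℂ) (j : ℕ) : coeff j (eulerD φ) = j * coeff j φ := by
  change coeff j (X * PowerSeries.derivative ℂ φ) = _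
  cases j with
  | zero => simp
  | succ j => rw [coeff_succ_X_mul, coeff_derivative]; push_cast; ring

lemma eulerD_X_pow (m : ℕ) : eulerD (X ^ m) = (m : PowerSeries ℂ) * X ^ m := by
  ext j
  rw [coeff_eulerD, ← map_natCast C, coeff_C_mul, coeff_X_pow]
  split_ifs with h <;> simp [h]

lemma eulerD_mem_convergentSeries (P : Polynomial ℂ) :
    eulerD (P : PowerSeries ℂ) ∈ convergentSeries := by
  have : eulerD (P : PowerSeries ℂ) =
      ((Polynomial.X * P.derivative : Polynomial ℂ) : PowerSeries ℂ) := by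
    ext j
    rw [coeff_eulerD, Polynomial.coeff_coe, Polynomial.coeff_coe]
    cases j with
    | zero => simp
    | succ j => rw [Polynomial.coeff_X_mul, Polynomial.coeff_derivative]; push_cast; ring
  rw [this]
  exact polynomial_mem_convergentSeries _

/-- The operator `θ + N` expands majorants by the factor `N`; this plays the role of
the invertibility of `θ + N - β` for large `N`. -/
lemma mul_partialNorm_le {ρ : ℝ} (hρ : 0 ≤ ρ) (N J : ℕ) (φ : PowerSeries ℂ) :
    N * partialNorm ρ J φ ≤ partialNorm ρ J (eulerD φ + (N : PowerSeries ℂ) * φ) := by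
  unfold partialNorm
  rw [mul_sum]
  refine sum_le_sum fun j _ => ?_
  rw [map_add, coeff_eulerD, ← map_natCast C, coeff_C_mul, ← add_mul, norm_mul, ← mul_assoc,
    ← Nat.cast_add, Complex.norm_natCast]
  gcongr
  omega

/-- Majorant argument: a formal solution of `θ v + N v = h + β v + z E(z, v)` with convergent data
converges as soon as `N` dominates `β(0)`. -/
lemma isConvergent_of_large_shift {n : ℕ} {N : ℕ} {v h : Fin n → PowerSeries ℂ}
    {β : Fin n → Fin n → PowerSeries ℂ} {E : Fin n → MvPolynomial (Fin n) convergentSeries}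
    (hh : ∀ i, IsConvergent (h i)) (hβ : ∀ i j, IsConvergent (β i j))
    (hN : (∑ i, ∑ j, (‖constantCoeff (β i j)‖ + 1)) + 1 ≤ N)
    (heq : ∀ i, eulerD (v i) + (N : PowerSeries ℂ) * v i =
      h i + ∑ j, β i j * v j + X * MvPolynomial.aeval v (E i)) (i : Fin n) :
    IsConvergent (v i) := by
  choose K hK using fun i => (hh i).eventually
  set M := ∑ i, K i + 1 with hM
  choose Q hQ using fun i => exists_partialNorm_aeval_le (E i) M
  have hB : ∀ᶠ ρ in 𝓝[>] (0 : ℝ), ∀ i j J,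
      partialNorm ρ J (β i j) ≤ ‖constantCoeff (β i j)‖ + 1 := by
    rw [eventually_all]; intro i
    rw [eventually_all]; intro j
    exact (hβ i j).eventually_le (lt_add_one _)
  have hsmall : ∀ᶠ ρ in 𝓝[>] (0 : ℝ), ρ * ∑ i, Q i < 1 := by
    have : Tendsto (fun ρ : ℝ => ρ * ∑ i, Q i) (𝓝 0) (𝓝 (0 * ∑ i, Q i)) := by
      apply Continuous.tendsto
      fun_prop
    rw [zero_mul] at this
    exact (this.mono_left nhdsWithin_le_nhds).eventually_lt_const one_pos
  have hM0 : 0 ≤ M := by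
    have : ∀ i, 0 ≤ K i := fun i => by
      obtain ⟨ρ, h1, h2⟩ := ((hK i).and self_mem_nhdsWithin).exists
      exact (partialNorm_nonneg (le_of_lt h2) 0 (h i)).trans (h1 0)
    have := sum_nonneg fun i (_ : i ∈ univ) => this i
    linarith
  refine isConvergent_of_eventually (K := M) ?_
  filter_upwards [eventually_all.2 hK, eventually_all.2 hQ, hB, hsmall, self_mem_nhdsWithin]
    with ρ h1 h2 h3 h4 (h5 : 0 < ρ)
  -- The factor `z` in front of `E` makes the bound at length `J + 1` depend on `E(v)` only
  -- through its terms of length `J`.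
  have key : ∀ J, ∑ i, partialNorm ρ J (v i) ≤ M := by
    intro J
    induction J with
    | zero => simpa [partialNorm] using hM0
    | succ J ih =>
      have hv : ∀ J j, partialNorm ρ J (v j) ≤ ∑ i, partialNorm ρ J (v i) := fun J j =>
        single_le_sum (f := fun i => partialNorm ρ J (v i))
          (fun i _ => partialNorm_nonneg h5.le _ _) (mem_univ j)
      set s := ∑ i, partialNorm ρ (J + 1) (v i) with hs
      have hs0 : 0 ≤ s := sum_nonneg fun i _ => partialNorm_nonneg h5.le _ _
      have hi : ∀ i, N * partialNorm ρ (J + 1) (v i) ≤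
          K i + (∑ j, (‖constantCoeff (β i j)‖ + 1)) * s + ρ * Q i := by
        intro i
        refine (mul_partialNorm_le h5.le N _ _).trans ?_
        rw [heq i]
        refine (partialNorm_add_le h5.le _ _ _).trans (add_le_add ?_ ?_)
        · refine (partialNorm_add_le h5.le _ _ _).trans (add_le_add (h1 i _) ?_)
          refine (partialNorm_sum_le h5.le _ _ _).trans ?_
          rw [sum_mul]
          refine sum_le_sum fun j _ => (partialNorm_mul_le h5.le _ _ _).trans ?_
          exact mul_le_mul (h3 i j _) (hv _ j) (partialNorm_nonneg h5.le _ _) (by positivity)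
        · rw [partialNorm_X_mul]
          exact mul_le_mul_of_nonneg_left (h2 i J v fun j => (hv J j).trans ih) h5.le
      have hsum := sum_le_sum fun i (_ : i ∈ univ) => hi i
      rw [← mul_sum, sum_add_distrib, sum_add_distrib, ← sum_mul, ← mul_sum, ← hs] at hsum
      have hNs := mul_le_mul_of_nonneg_right hN hs0
      linarith
  intro J
  exact (single_le_sum (f := fun i => partialNorm ρ J (v i))
    (fun i _ => partialNorm_nonneg h5.le _ _) (mem_univ i)).trans (key J)

/-- Second order Taylor formula for a polynomial at `b`, in the direction `s v`, with a remainder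
that is a polynomial in `v` over the ring of coefficients. -/
lemma exists_taylor_remainder {σ R A : Type*} [Fintype σ] [CommRing R] [CommRing A] [Algebra R A]
    (F : MvPolynomial σ R) (b : σ → R) (s : R) :
    ∃ E : MvPolynomial σ R, ∀ v : σ → A,
      MvPolynomial.aeval (fun i => algebraMap R A (b i) + algebraMap R A s * v i) F =
        algebraMap R A (MvPolynomial.eval b F) +
        algebraMap R A s *
          ∑ j, algebraMap R A (MvPolynomial.eval b (MvPolynomial.pderiv j F)) * v j +
        algebraMap R A s ^ 2 * MvPolynomial.aeval v E := by
  classical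
  induction F using MvPolynomial.induction_on with
  | C a => exact ⟨0, fun v => by simp⟩
  | add p q hp hq =>
    obtain ⟨E, hE⟩ := hp
    obtain ⟨E', hE'⟩ := hq
    refine ⟨E + E', fun v => ?_⟩
    simp only [map_add, hE, hE', add_mul, sum_add_distrib]
    ring
  | mul_X p i hp =>
    obtain ⟨E, hE⟩ := hp
    refine ⟨(∑ j, MvPolynomial.C (MvPolynomial.eval b (MvPolynomial.pderiv j p)) *
      MvPolynomial.X j) * MvPolynomial.X i + E * MvPolynomial.C (b i) +
      MvPolynomial.C s * E * MvPolynomial.X i, fun v => ?_⟩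
    have hsum : ∑ j, algebraMap R A
        (MvPolynomial.eval b (MvPolynomial.pderiv j (p * MvPolynomial.X i))) * v j =
        algebraMap R A (MvPolynomial.eval b p) * v i + algebraMap R A (b i) *
          ∑ j, algebraMap R A (MvPolynomial.eval b (MvPolynomial.pderiv j p)) * v j := by
      simp only [MvPolynomial.pderiv_mul, MvPolynomial.pderiv_X, map_add, map_mul, add_mul,
        sum_add_distrib, MvPolynomial.eval_X, mul_sum]
      rw [add_comm]
      congr 1
      · rw [sum_eq_single i]
        · simp
        · intro j _ hj
          simp [hj.symm]
        · simp
      · exact sum_congr rfl fun j _ => by ring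
    rw [hsum]
    simp only [map_add, map_mul, hE, map_sum, MvPolynomial.aeval_X, MvPolynomial.aeval_C,
      MvPolynomial.eval_X]
    ring

/-- A formal power series solution `w` of `z^c θw = F(z, w)`, `F` polynomial in `w` with
convergent coefficients, converges if the linearization of `F` along `w` is divisible by `z^c`, so
that the linearized system has a regular singular point. Subtracting a long truncation of `w`
reduces the system to one in which the shift `N` dominates the linear part. -/
theorem isConvergent_of_regular_linearization {n c : ℕ}
    {F : Fin n → MvPolynomial (Fin n) convergentSeries} {w : Fin n → PowerSeries ℂ}
    (heq : ∀ i, X ^ c * eulerD (w i) = MvPolynomial.aeval w (F i))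
    (hlin : ∀ i j, X ^ c ∣ MvPolynomial.aeval w (MvPolynomial.pderiv j (F i))) (i : Fin n) :
    IsConvergent (w i) := by
  choose G hG using hlin
  -- The bound involves only constant terms of `G`, which truncating `w` beyond order `c` keeps.
  obtain ⟨N₀, hN₀⟩ := exists_nat_ge ((∑ i, ∑ j, (‖constantCoeff (G i j)‖ + 1)) + 1)
  set N := N₀ + c + 1 with hN
  set b : Fin n → convergentSeries := fun i =>
    ⟨trunc N (w i), polynomial_mem_convergentSeries _⟩ with hb
  set s : convergentSeries := ⟨X ^ N, pow_mem X_mem_convergentSeries N⟩ with hs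
  have hdiv : ∀ i, ∃ v, w i - (trunc N (w i) : PowerSeries ℂ) = X ^ N * v := fun i =>
    X_pow_dvd_iff.2 fun m hm => by
      rw [map_sub, Polynomial.coeff_coe, coeff_trunc, if_pos hm, sub_self]
  choose v hv using hdiv
  have hw : w = fun i => algebraMap convergentSeries (PowerSeries ℂ) (b i) +
      algebraMap convergentSeries (PowerSeries ℂ) s * v i := by
    funext i
    change w i = (trunc N (w i) : PowerSeries ℂ) + X ^ N * v i
    rw [← hv]; ring
  have hsX : algebraMap convergentSeries (PowerSeries ℂ) s = X ^ N := rfl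
  -- The linearization along the truncation agrees with the one along `w` to order `N > c`.
  have hβ : ∀ i j, ∃ β, algebraMap convergentSeries (PowerSeries ℂ)
      (MvPolynomial.eval b (MvPolynomial.pderiv j (F i))) = X ^ c * β ∧
      constantCoeff β = constantCoeff (G i j) := by
    intro i j
    obtain ⟨E, hE⟩ := exists_taylor_remainder (A := PowerSeries ℂ)
      (MvPolynomial.pderiv j (F i)) b s
    have h := hE v
    rw [← hw, hG, hsX] at h
    have hXN : (X : PowerSeries ℂ) ^ N = X ^ c * (X * X ^ N₀) := by rw [hN]; ring
    set L := ∑ k, algebraMap convergentSeries (PowerSeries ℂ) (MvPolynomial.eval b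
      (MvPolynomial.pderiv k (MvPolynomial.pderiv j (F i)))) * v k
    refine ⟨G i j - X * X ^ N₀ * (L + X ^ N * MvPolynomial.aeval v E), ?_, by simp⟩
    rw [mul_sub, h, ← mul_assoc (X ^ c), ← hXN]
    ring
  choose β hβ hβ0 using hβ
  have hbetaconv : ∀ i j, IsConvergent (β i j) := fun i j =>
    .of_X_pow_mul c (hβ i j ▸ (MvPolynomial.eval b (MvPolynomial.pderiv j (F i))).2)
  choose E hE using fun i => exists_taylor_remainder (A := PowerSeries ℂ) (F i) b s
  set sX : convergentSeries := ⟨X ^ N₀, pow_mem X_mem_convergentSeries N₀⟩ with hsX'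
  have hE' : ∀ i, X * MvPolynomial.aeval v (MvPolynomial.C sX * E i) =
      X ^ (N₀ + 1) * MvPolynomial.aeval v (E i) := by
    intro i
    rw [map_mul, MvPolynomial.aeval_C, show algebraMap convergentSeries (PowerSeries ℂ) sX =
      X ^ N₀ from rfl]
    ring
  -- The inhomogeneous term is defined by the reduced equation; it converges because
  -- `z^(N + c) h` is the defect of the truncation `b` in the original equation.
  set h : Fin n → PowerSeries ℂ := fun i => eulerD (v i) + (N : PowerSeries ℂ) * v i -
    ∑ j, β i j * v j - X * MvPolynomial.aeval v (MvPolynomial.C sX * E i) with hh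
  have hhconv : ∀ i, IsConvergent (h i) := by
    intro i
    have h1 : X ^ (N + c) * h i =
        algebraMap convergentSeries (PowerSeries ℂ) (MvPolynomial.eval b (F i)) -
          X ^ c * eulerD (trunc N (w i) : PowerSeries ℂ) := by
      have h2 := hE i v
      rw [← hw, ← heq, hsX] at h2
      have h3 : eulerD (w i) = eulerD (trunc N (w i) : PowerSeries ℂ) +
          X ^ N * (eulerD (v i) + (N : PowerSeries ℂ) * v i) := by
        have := congrArg eulerD (hv i)
        rw [map_sub, Derivation.leibniz, eulerD_X_pow, smul_eq_mul, smul_eq_mul] at this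
        linear_combination this
      have h4 : ∑ j, algebraMap convergentSeries (PowerSeries ℂ)
          (MvPolynomial.eval b (MvPolynomial.pderiv j (F i))) * v j =
          X ^ c * ∑ j, β i j * v j := by
        rw [mul_sum]
        exact sum_congr rfl fun j _ => by rw [hβ]; ring
      rw [h3, h4] at h2
      rw [hh]
      simp only [hE']
      have h5 : (X : PowerSeries ℂ) ^ (N + c) * X ^ (N₀ + 1) = (X ^ N) ^ 2 := by rw [hN]; ring
      linear_combination h2 - MvPolynomial.aeval v (E i) * h5
    refine .of_X_pow_mul (N + c) (h1 ▸ ?_)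
    exact sub_mem (MvPolynomial.eval b (F i)).2
      (mul_mem (pow_mem X_mem_convergentSeries c) (eulerD_mem_convergentSeries _))
  have hvconv := isConvergent_of_large_shift (N := N) (v := v)
    (E := fun i => MvPolynomial.C sX * E i) hhconv hbetaconv (by
    simp only [hβ0]
    refine hN₀.trans ?_
    exact_mod_cast (by omega : N₀ ≤ N)) (fun i => by simp only [hh]; ring) i
  rw [eq_add_of_sub_eq' (hv i)]
  exact add_mem (s := convergentSeries) (polynomial_mem_convergentSeries _)
    (mul_mem (pow_mem X_mem_convergentSeries N) hvconv)

/-! ### Formal Laurent series -/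

lemma coeff_laurentDerivative (F : LaurentSeries ℂ) (m : ℤ) :
    (LaurentSeries.derivative ℂ F).coeff m = (m + 1) * F.coeff (m + 1) := by
  rw [LaurentSeries.derivative_apply, LaurentSeries.hasseDeriv_coeff]
  simp [Ring.choose_one_right']

lemma coeff_ofPowerSeries (φ : PowerSeries ℂ) (e : ℤ) :
    (HahnSeries.ofPowerSeries ℤ ℂ φ).coeff e = if 0 ≤ e then coeff e.toNat φ else 0 := by
  split_ifs with h
  · lift e to ℕ using h
    rw [LaurentSeries.coeff_coe_powerSeries, Int.toNat_natCast]
  · rw [HahnSeries.ofPowerSeries_apply, HahnSeries.embDomain_of_notMem_range]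
    rintro ⟨m, rfl⟩
    exact h (by simp)

lemma coeff_single_mul_ofPowerSeries (d e : ℤ) (φ : PowerSeries ℂ) :
    (HahnSeries.single d (1 : ℂ) * HahnSeries.ofPowerSeries ℤ ℂ φ).coeff e =
      if 0 ≤ e - d then coeff (e - d).toNat φ else 0 := by
  rw [HahnSeries.coeff_single_mul, one_mul, coeff_ofPowerSeries]

lemma coeff_laurentOf (k : ℤ) (a : ℕ → ℂ) (e : ℤ) :
    (laurentOf k a).coeff e = if 0 ≤ e + k then a (e + k).toNat else 0 := by
  rw [laurentOf, coeff_single_mul_ofPowerSeries, sub_neg_eq_add, coeff_mk]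

lemma coeff_taylorLaurent (c : ℂ → ℂ) (t₀ : ℂ) (e : ℤ) :
    (taylorLaurent c t₀).coeff e =
      if 0 ≤ e then iteratedDeriv e.toNat c t₀ / (e.toNat.factorial : ℂ) else 0 := by
  rw [taylorLaurent, coeff_ofPowerSeries, coeff_mk]

/-- The Cauchy product as a sum over an explicit interval, which serves all series with the same
bounds on their orders at once. -/
lemma coeff_mul_eq_sum_Icc {F G : LaurentSeries ℂ} {a b : ℤ} (hF : ∀ i < a, F.coeff i = 0)
    (hG : ∀ i < b, G.coeff i = 0) (m : ℤ) :
    (F * G).coeff m = ∑ i ∈ Icc a (m - b), F.coeff i * G.coeff (m - i) := by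
  rw [HahnSeries.coeff_mul, ← sum_image (g := fun i => (i, m - i))
    (f := fun q : ℤ × ℤ => F.coeff q.1 * G.coeff q.2) (fun i _ j _ h => (Prod.ext_iff.1 h).1)]
  apply sum_subset
  · rintro ⟨i, j⟩ hij
    simp only [Finset.mem_antidiagonal, HahnSeries.mem_support] at hij
    have h1 : a ≤ i := not_lt.1 fun h => hij.1 (hF i h)
    have h2 : b ≤ j := not_lt.1 fun h => hij.2.1 (hG j h)
    exact mem_image.2 ⟨i, mem_Icc.2 ⟨h1, by lia⟩, Prod.ext rfl (by lia)⟩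
  · rintro ⟨i, j⟩ hij hn
    obtain ⟨i', -, h⟩ := mem_image.1 hij
    simp only [Prod.mk.injEq] at h
    by_contra hne
    refine hn ?_
    simp only [Finset.mem_antidiagonal, HahnSeries.mem_support]
    exact ⟨left_ne_zero_of_mul hne, right_ne_zero_of_mul hne, by lia⟩

lemma exists_coeff_eq_zero (F : LaurentSeries ℂ) : ∃ a : ℤ, ∀ i < a, F.coeff i = 0 :=
  ⟨F.order, fun _ => HahnSeries.coeff_eq_zero_of_lt_order⟩

lemma laurentDerivative_mul (F G : LaurentSeries ℂ) :
    LaurentSeries.derivative ℂ (F * G) =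
      LaurentSeries.derivative ℂ F * G + F * LaurentSeries.derivative ℂ G := by
  obtain ⟨a, hF⟩ := exists_coeff_eq_zero F
  obtain ⟨b, hG⟩ := exists_coeff_eq_zero G
  have hF' : ∀ i < a - 1, (LaurentSeries.derivative ℂ F).coeff i = 0 := fun i hi => by
    rw [coeff_laurentDerivative, hF _ (by lia), mul_zero]
  have hG' : ∀ i < b - 1, (LaurentSeries.derivative ℂ G).coeff i = 0 := fun i hi => by
    rw [coeff_laurentDerivative, hG _ (by lia), mul_zero]
  ext m
  have hshift : ∑ i ∈ Icc (a - 1) (m - b),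
      (LaurentSeries.derivative ℂ F).coeff i * G.coeff (m - i) =
      ∑ i ∈ Icc a (m + 1 - b), i * F.coeff i * G.coeff (m + 1 - i) := by
    refine sum_nbij' (fun i => i + 1) (fun i => i - 1) ?_ ?_ ?_ ?_ ?_
    · intro i hi
      simp only [mem_Icc] at hi ⊢
      lia
    · intro i hi
      simp only [mem_Icc] at hi ⊢
      lia
    · intro i _
      ring
    · intro i _
      ring
    · intro i _
      rw [coeff_laurentDerivative, show m + 1 - (i + 1) = m - i by ring]
      push_cast
      ring
  rw [HahnSeries.coeff_add, coeff_laurentDerivative, coeff_mul_eq_sum_Icc hF hG,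
    coeff_mul_eq_sum_Icc hF' hG, coeff_mul_eq_sum_Icc hF hG', hshift,
    show m - (b - 1) = m + 1 - b by ring, ← sum_add_distrib, mul_sum]
  refine sum_congr rfl fun i _ => ?_
  rw [coeff_laurentDerivative, show m - i + 1 = m + 1 - i by ring]
  push_cast
  ring

lemma laurentDerivative_one : LaurentSeries.derivative ℂ (1 : LaurentSeries ℂ) = 0 := by
  have := laurentDerivative_mul 1 1
  simpa only [mul_one, one_mul, left_eq_add] using this

lemma laurentDerivative_single_mul (e : ℤ) (φ : PowerSeries ℂ) :
    LaurentSeries.derivative ℂ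
        (HahnSeries.single e (1 : ℂ) * HahnSeries.ofPowerSeries ℤ ℂ φ) =
      HahnSeries.single (e - 1) (1 : ℂ) *
        HahnSeries.ofPowerSeries ℤ ℂ (C (e : ℂ) * φ + eulerD φ) := by
  ext m
  rw [coeff_laurentDerivative, coeff_single_mul_ofPowerSeries, coeff_single_mul_ofPowerSeries,
    show m - (e - 1) = m + 1 - e by ring]
  split_ifs with h
  · rw [map_add, coeff_C_mul, coeff_eulerD, ← add_mul]
    congr 1
    have : ((m + 1 - e).toNat : ℂ) = ((m + 1 - e : ℤ) : ℂ) := by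
      rw [← Int.cast_natCast, Int.toNat_of_nonneg h]
    rw [this]
    push_cast
    ring
  · simp

lemma coeff_C_mul_laurent (a : ℂ) (F : LaurentSeries ℂ) (m : ℤ) :
    (HahnSeries.C a * F).coeff m = a * F.coeff m := by
  rw [HahnSeries.C_apply, HahnSeries.coeff_single_zero_mul]

lemma laurentDerivative_C_mul (a : ℂ) (F : LaurentSeries ℂ) :
    LaurentSeries.derivative ℂ (HahnSeries.C a * F) =
      HahnSeries.C a * LaurentSeries.derivative ℂ F := by
  ext m
  simp only [coeff_laurentDerivative, coeff_C_mul_laurent]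
  ring

/-! ### Families of Laurent series depending on a parameter -/

/-- The coefficients of the family `F` of Laurent series, whose orders are bounded below, are
differentiable at the parameter value `0`; the derivatives are the coefficients of `G`. -/
structure HasCoeffDeriv (F : ℂ → LaurentSeries ℂ) (G : LaurentSeries ℂ) : Prop where
  bdd : ∃ e : ℤ, ∀ s, ∀ i < e, (F s).coeff i = 0
  deriv : ∀ i, HasDerivAt (fun s => (F s).coeff i) (G.coeff i) 0

namespace HasCoeffDeriv

variable {F F' : ℂ → LaurentSeries ℂ} {G G' : LaurentSeries ℂ}

lemma const (F : LaurentSeries ℂ) : HasCoeffDeriv (fun _ => F) 0 where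
  bdd := (exists_coeff_eq_zero F).imp fun _ h _ => h
  deriv _ := hasDerivAt_const _ _

lemma add (h : HasCoeffDeriv F G) (h' : HasCoeffDeriv F' G') :
    HasCoeffDeriv (fun s => F s + F' s) (G + G') where
  bdd := by
    obtain ⟨e, he⟩ := h.bdd
    obtain ⟨e', he'⟩ := h'.bdd
    refine ⟨min e e', fun s i hi => ?_⟩
    rw [HahnSeries.coeff_add, he s i (by lia), he' s i (by lia), add_zero]
  deriv i := (h.deriv i).add (h'.deriv i)

lemma mul (h : HasCoeffDeriv F G) (h' : HasCoeffDeriv F' G') :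
    HasCoeffDeriv (fun s => F s * F' s) (G * F' 0 + F 0 * G') := by
  obtain ⟨e, he⟩ := h.bdd
  obtain ⟨e', he'⟩ := h'.bdd
  have hG : ∀ i < e, G.coeff i = 0 := fun i hi =>
    (h.deriv i).unique (by simpa [he _ i hi] using hasDerivAt_const (0 : ℂ) (0 : ℂ))
  have hG' : ∀ i < e', G'.coeff i = 0 := fun i hi =>
    (h'.deriv i).unique (by simpa [he' _ i hi] using hasDerivAt_const (0 : ℂ) (0 : ℂ))
  refine ⟨⟨e + e', fun s i hi => ?_⟩, fun m => ?_⟩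
  · rw [coeff_mul_eq_sum_Icc (he s) (he' s), Icc_eq_empty (by lia), sum_empty]
  · have : (fun s => (F s * F' s).coeff m) =
        fun s => ∑ i ∈ Icc e (m - e'), (F s).coeff i * (F' s).coeff (m - i) :=
      funext fun s => coeff_mul_eq_sum_Icc (he s) (he' s) m
    rw [this, HahnSeries.coeff_add, coeff_mul_eq_sum_Icc hG (he' 0),
      coeff_mul_eq_sum_Icc (he 0) hG', ← sum_add_distrib]
    exact HasDerivAt.fun_sum fun i _ => (h.deriv i).mul (h'.deriv (m - i))

lemma derivative (h : HasCoeffDeriv F G) :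
    HasCoeffDeriv (fun s => LaurentSeries.derivative ℂ (F s))
      (LaurentSeries.derivative ℂ G) := by
  obtain ⟨e, he⟩ := h.bdd
  refine ⟨⟨e - 1, fun s i hi => ?_⟩, fun i => ?_⟩
  · rw [coeff_laurentDerivative, he s _ (by lia), mul_zero]
  · simp only [coeff_laurentDerivative]
    exact (h.deriv (i + 1)).const_mul _

lemma unique (h : HasCoeffDeriv F G) (h' : HasCoeffDeriv F' G') (hF : F =ᶠ[𝓝 0] F') :
    G = G' := by
  ext i
  refine (h.deriv i).unique ((h'.deriv i).congr_of_eventuallyEq ?_)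
  exact hF.mono fun s hs => congrArg (fun H => H.coeff i) hs

end HasCoeffDeriv

/-- `V` is the derivative `∂F/∂s - ε ∂F/∂z` at `s = 0` of the family `F` of Laurent series in `z`.
For `z = t - t₀`, where `t₀` moves with speed `ε` as `s` varies, this is the derivative
at constant `t`, and it annihilates the Taylor series at `t₀` of a fixed function of `t`. -/
def HasMovingDeriv (ε : ℂ) (F : ℂ → LaurentSeries ℂ) (V : LaurentSeries ℂ) : Prop :=
  HasCoeffDeriv F (V + HahnSeries.C ε * LaurentSeries.derivative ℂ (F 0))

namespace HasMovingDeriv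

variable {ε : ℂ} {F F' : ℂ → LaurentSeries ℂ} {V V' : LaurentSeries ℂ}

lemma add (h : HasMovingDeriv ε F V) (h' : HasMovingDeriv ε F' V') :
    HasMovingDeriv ε (fun s => F s + F' s) (V + V') := by
  have := HasCoeffDeriv.add h h'
  unfold HasMovingDeriv
  convert this using 1
  rw [map_add]
  ring

lemma mul (h : HasMovingDeriv ε F V) (h' : HasMovingDeriv ε F' V') :
    HasMovingDeriv ε (fun s => F s * F' s) (V * F' 0 + F 0 * V') := by
  have := HasCoeffDeriv.mul h h'
  unfold HasMovingDeriv
  convert this using 1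
  rw [laurentDerivative_mul]
  ring

lemma of_algebraMap (a : ℂ) :
    HasMovingDeriv ε (fun _ => algebraMap ℂ (LaurentSeries ℂ) a) 0 := by
  have h : LaurentSeries.derivative ℂ (algebraMap ℂ (LaurentSeries ℂ) a) = 0 := by
    rw [HahnSeries.algebraMap_apply', PowerSeries.algebraMap_apply,
      Algebra.algebraMap_self_apply, HahnSeries.ofPowerSeries_C, ← mul_one (HahnSeries.C a),
      laurentDerivative_C_mul, laurentDerivative_one, mul_zero]
  unfold HasMovingDeriv
  rw [h, mul_zero, add_zero]
  exact .const _

lemma sum {ι : Type*} (s : Finset ι) {F : ι → ℂ → LaurentSeries ℂ} {V : ι → LaurentSeries ℂ}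
    (h : ∀ i ∈ s, HasMovingDeriv ε (F i) (V i)) :
    HasMovingDeriv ε (fun x => ∑ i ∈ s, F i x) (∑ i ∈ s, V i) := by
  classical
  induction s using Finset.induction_on with
  | empty => simpa using of_algebraMap (ε := ε) 0
  | insert a s ha ih =>
    simp only [sum_insert ha]
    exact (h a (mem_insert_self a s)).add (ih fun i hi => h i (mem_insert_of_mem hi))

lemma derivative (h : HasMovingDeriv ε F V) :
    HasMovingDeriv ε (fun s => LaurentSeries.derivative ℂ (F s))
      (LaurentSeries.derivative ℂ V) := by
  have := HasCoeffDeriv.derivative h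
  rwa [map_add, laurentDerivative_C_mul] at this

lemma unique (h : HasMovingDeriv ε F V) (h' : HasMovingDeriv ε F' V') (hF : F =ᶠ[𝓝 0] F') :
    V = V' := by
  have := HasCoeffDeriv.unique h h' hF
  rw [hF.eq_of_nhds] at this
  exact add_right_cancel this

/-- Chain rule for polynomials with constant coefficients. -/
lemma aeval {σ : Type*} [Fintype σ] {U : ℂ → σ → LaurentSeries ℂ} {V : σ → LaurentSeries ℂ}
    (h : ∀ j, HasMovingDeriv ε (fun s => U s j) (V j)) (Q : MvPolynomial σ ℂ) :
    HasMovingDeriv ε (fun s => MvPolynomial.aeval (U s) Q)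
      (∑ j, MvPolynomial.aeval (U 0) (MvPolynomial.pderiv j Q) * V j) := by
  classical
  induction Q using MvPolynomial.induction_on with
  | C a => simpa using of_algebraMap (ε := ε) a
  | add p q hp hq => simpa only [map_add, add_mul, sum_add_distrib] using hp.add hq
  | mul_X p i hp =>
    have := hp.mul (h i)
    simp only [map_mul, MvPolynomial.aeval_X]
    convert this using 1
    simp only [MvPolynomial.pderiv_mul, MvPolynomial.pderiv_X, map_add, map_mul, add_mul,
      sum_add_distrib, MvPolynomial.aeval_X, sum_mul]
    congr 1
    · exact sum_congr rfl fun j _ => by ring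
    · rw [sum_eq_single i]
      · simp
      · intro j _ hj
        simp [hj.symm]
      · simp

lemma taylorLaurent {c : ℂ → ℂ} {t₀ : ℂ} (hc : AnalyticAt ℂ c t₀) :
    HasMovingDeriv ε (fun s => taylorLaurent c (t₀ + s * ε)) 0 := by
  unfold HasMovingDeriv
  refine ⟨⟨0, fun s i hi => ?_⟩, fun i => ?_⟩
  · rw [coeff_taylorLaurent, if_neg (by lia)]
  · simp only [zero_add, coeff_C_mul_laurent, coeff_laurentDerivative, coeff_taylorLaurent,
      zero_mul, add_zero]
    by_cases hi : 0 ≤ i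
    · lift i to ℕ using hi
      have h1 : HasDerivAt (iteratedDeriv i c) (iteratedDeriv (i + 1) c t₀) (t₀ + 0 * ε) := by
        rw [zero_mul, add_zero, iteratedDeriv_succ, hasDerivAt_deriv_iff, iteratedDeriv_eq_iterate]
        exact (hc.iterated_deriv i).differentiableAt
      have h2 : HasDerivAt (fun s : ℂ => t₀ + s * ε) ε 0 := by
        simpa using ((hasDerivAt_id (0 : ℂ)).mul_const ε).const_add t₀
      have h3 := (h1.comp 0 h2).div_const (i.factorial : ℂ)
      have hi' : ((i : ℤ) + 1).toNat = i + 1 := by lia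
      simp only [Int.natCast_nonneg, if_true, Int.toNat_natCast, hi',
        if_pos (by lia : 0 ≤ (i : ℤ) + 1)]
      refine h3.congr_deriv ?_
      have hf : (i.factorial : ℂ) ≠ 0 := by exact_mod_cast i.factorial_ne_zero
      have hs : (i : ℂ) + 1 ≠ 0 := by exact_mod_cast i.succ_ne_zero
      rw [Nat.factorial_succ]
      push_cast
      field_simp
    · simp only [if_neg hi]
      -- For `i = -1` the factor `i + 1` of the `z`-derivative vanishes.
      have h0 : ((i : ℂ) + 1) * (if 0 ≤ i + 1 then iteratedDeriv (i + 1).toNat c t₀ /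
          ((i + 1).toNat.factorial : ℂ) else 0) = 0 := by
        split_ifs with h
        · obtain rfl : i = -1 := by lia
          simp
        · simp
      rw [h0, mul_zero]
      exact hasDerivAt_const _ _

lemma laurentOf {a : ℕ → ℂ → ℂ} {a' : ℕ → ℂ} (k : ℤ)
    (h : ∀ j, HasDerivAt (a j) (a' j) 0) :
    HasMovingDeriv ε (fun s => laurentOf k fun j => a j s)
      (laurentOf k a' - HahnSeries.C ε * LaurentSeries.derivative ℂ (laurentOf k fun j => a j 0)) := by
  unfold HasMovingDeriv
  rw [sub_add_cancel]
  refine ⟨⟨-k, fun s i hi => ?_⟩, fun i => ?_⟩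
  · rw [coeff_laurentOf, if_neg (by lia)]
  · simp only [coeff_laurentOf]
    split_ifs
    · exact h _
    · exact hasDerivAt_const _ _

end HasMovingDeriv

/-! ### The linearized system -/

/-- The entry `∂P/∂uⱼ (t₀ + z, U(z))` of the formal Jacobian matrix, as a Laurent series in
`z = t - t₀`. -/
noncomputable def jacobianLaurent {n : ℕ} (P : MvPolynomial (Fin n) (ℂ → ℂ)) (t₀ : ℂ)
    (U : Fin n → LaurentSeries ℂ) (j : Fin n) : LaurentSeries ℂ :=
  ∑ m ∈ P.support, taylorLaurent (P.coeff m) t₀ *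
    MvPolynomial.aeval U (MvPolynomial.pderiv j (MvPolynomial.monomial m (1 : ℂ)))

lemma aeval_monomial_one {n : ℕ} {A : Type*} [CommRing A] [Algebra ℂ A] (U : Fin n → A)
    (m : Fin n →₀ ℕ) :
    MvPolynomial.aeval U (MvPolynomial.monomial m (1 : ℂ)) = ∏ j, U j ^ m j := by
  rw [MvPolynomial.aeval_monomial, map_one, one_mul, Finsupp.prod_fintype _ _ (by simp)]

/-- The derivative of a family of formal solutions with respect to a parameter solves the
linearized system. -/
lemma linearized_of_family {n : ℕ} (S : RegularODE n) {t₀ ε : ℂ} (ht₀ : t₀ ∈ S.T)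
    {U : ℂ → Fin n → LaurentSeries ℂ} {V : Fin n → LaurentSeries ℂ}
    (hV : ∀ j, HasMovingDeriv ε (fun s => U s j) (V j))
    (hsol : ∀ᶠ s in 𝓝 0, S.IsFormalSolution (t₀ + s * ε) (U s)) (i : Fin n) :
    LaurentSeries.derivative ℂ (V i) = ∑ j, jacobianLaurent (S.f i) t₀ (U 0) j * V j := by
  have h1 := HasMovingDeriv.sum (S.f i).support fun m _ =>
    (HasMovingDeriv.taylorLaurent (ε := ε) (S.analytic_coeff i m t₀ ht₀)).mul
      (HasMovingDeriv.aeval hV (MvPolynomial.monomial m 1))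
  have h2 := (hV i).derivative.unique h1 (hsol.mono fun s hs => by
    simp only [hs i, substLaurent, aeval_monomial_one])
  rw [h2]
  simp only [jacobianLaurent, zero_mul, zero_add, add_zero, mul_sum, sum_mul]
  rw [sum_comm]
  exact sum_congr rfl fun j _ => sum_congr rfl fun m _ => by ring

/-- If a linear system `V' = A V` over formal Laurent series has a fundamental matrix
`z^(-K) M(z) z^μ` with `M(0)` invertible, then `z^K A z^(-K)` has at most a simple pole. -/
lemma exists_simple_pole_of_fundamental {n : ℕ} {k μ : Fin n → ℤ}
    {A : Matrix (Fin n) (Fin n) (LaurentSeries ℂ)} {M : Matrix (Fin n) (Fin n) (PowerSeries ℂ)}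
    (hM : IsUnit (M.map constantCoeff))
    (hA : ∀ i m, LaurentSeries.derivative ℂ (HahnSeries.single (μ m - k i) (1 : ℂ) *
        HahnSeries.ofPowerSeries ℤ ℂ (M i m)) =
      ∑ j, A i j * (HahnSeries.single (μ m - k j) (1 : ℂ) *
        HahnSeries.ofPowerSeries ℤ ℂ (M j m))) :
    ∃ B : Matrix (Fin n) (Fin n) (PowerSeries ℂ), ∀ i j,
      HahnSeries.single (k i - k j + 1) (1 : ℂ) * A i j =
        HahnSeries.ofPowerSeries ℤ ℂ (B i j) := by
  have hdet : IsUnit M.det := by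
    rw [isUnit_iff_constantCoeff, RingHom.map_det]
    exact (Matrix.isUnit_iff_isUnit_det _).1 hM
  set N : Matrix (Fin n) (Fin n) (PowerSeries ℂ) := Matrix.of fun i m =>
    C ((μ m - k i : ℤ) : ℂ) * M i m + eulerD (M i m) with hN
  set A' : Matrix (Fin n) (Fin n) (LaurentSeries ℂ) := Matrix.of fun i j =>
    HahnSeries.single (k i - k j + 1) (1 : ℂ) * A i j with hA'
  have h1 : A' * M.map (HahnSeries.ofPowerSeries ℤ ℂ) = N.map (HahnSeries.ofPowerSeries ℤ ℂ) := by
    ext1 i m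
    -- Multiplying by `z^(k i - μ m + 1)` turns the equation into one between power series.
    have h := congrArg (fun F => HahnSeries.single (k i - μ m + 1) (1 : ℂ) * F) (hA i m)
    simp only [laurentDerivative_single_mul, ← mul_assoc, HahnSeries.single_mul_single,
      mul_one, mul_sum] at h
    rw [show k i - μ m + 1 + (μ m - k i - 1) = 0 by ring] at h
    rw [Matrix.mul_apply]
    refine Eq.trans (sum_congr rfl fun j _ => ?_) (h.symm.trans ?_)
    · simp only [hA', Matrix.of_apply, Matrix.map_apply]
      rw [show k i - k j + 1 = (k i - μ m + 1) + (μ m - k j) by ring,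
        ← one_mul (1 : ℂ), ← HahnSeries.single_mul_single, one_mul]
      ring
    · simp [hN]
  refine ⟨N * M⁻¹, fun i j => ?_⟩
  have h2 : A' = (N * M⁻¹).map (HahnSeries.ofPowerSeries ℤ ℂ) := by
    rw [Matrix.map_mul, ← h1, Matrix.mul_assoc, ← Matrix.map_mul, Matrix.mul_nonsing_inv _ hdet,
      Matrix.map_one _ (map_zero _) (map_one _), Matrix.mul_one]
  exact congrFun (congrFun h2 i) j

/-! ### The fundamental matrix of a principal balance -/

namespace Balance

variable {n : ℕ} {S : RegularODE n}

/-- The formal solution with parameter values `p`. -/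
noncomputable def series (B : Balance S) (p : ℂ × (Fin B.q → ℂ)) (i : Fin n) : LaurentSeries ℂ :=
  laurentOf (B.k i) fun j => B.a i j p

/-- The derivative of the formal solutions in the direction `d` of the parameters, at constant `t`:
a change of `t₀` moves the local variable `z = t - t₀` as well. -/
noncomputable def variation (B : Balance S) (p d : ℂ × (Fin B.q → ℂ)) (i : Fin n) :
    LaurentSeries ℂ :=
  laurentOf (B.k i) (fun j => fderiv ℂ (B.a i j) p d) -
    HahnSeries.C d.1 * LaurentSeries.derivative ℂ (B.series p i)

lemma eventually_mem_Ω (B : Balance S) {p : ℂ × (Fin B.q → ℂ)} (hp : p ∈ B.Ω)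
    (d : ℂ × (Fin B.q → ℂ)) : ∀ᶠ s : ℂ in 𝓝 0, p + s • d ∈ B.Ω := by
  have hc : ContinuousAt (fun s : ℂ => p + s • d) 0 := by fun_prop
  exact hc.eventually_mem (by simpa using B.isOpen_Ω.mem_nhds hp)

lemma derivative_variation (B : Balance S) {p : ℂ × (Fin B.q → ℂ)} (hp : p ∈ B.Ω)
    (d : ℂ × (Fin B.q → ℂ)) (i : Fin n) :
    LaurentSeries.derivative ℂ (B.variation p d i) =
      ∑ j, jacobianLaurent (S.f i) p.1 (B.series p) j * B.variation p d j := by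
  have hV : ∀ j, HasMovingDeriv d.1 (fun s => B.series (p + s • d) j) (B.variation p d j) := by
    intro j
    have := HasMovingDeriv.laurentOf (ε := d.1) (B.k j) fun l =>
      (B.analytic_a j l p hp).differentiableAt.hasFDerivAt.hasLineDerivAt d
    simpa only [variation, series, zero_smul, add_zero] using this
  have h := linearized_of_family S (B.mem_T p hp) (U := fun s => B.series (p + s • d)) hV
    ((B.eventually_mem_Ω hp d).mono fun s hs => B.solution _ hs) i
  simpa only [zero_smul, add_zero] using h

lemma fderiv_eq_zero_of_lt (B : Balance S) {p : ℂ × (Fin B.q → ℂ)} (hp : p ∈ B.Ω)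
    (i : Fin n) {m : Fin B.q} {j : ℕ} (hj : j < B.res m) :
    fderiv ℂ (B.a i j) p (0, Pi.single m 1) = 0 := by
  have h := (B.analytic_a i j p hp).differentiableAt.hasFDerivAt.hasLineDerivAt
    ((0, Pi.single m 1) : ℂ × (Fin B.q → ℂ))
  refine HasDerivAt.unique h ((hasDerivAt_const (0 : ℂ) (B.a i j p)).congr_of_eventuallyEq ?_)
  filter_upwards [B.eventually_mem_Ω hp (0, Pi.single m 1)] with s hs
  refine B.depends i j _ hs _ hp (by simp) fun m' hm' => ?_
  have : m' ≠ m := by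
    rintro rfl
    omega
  simp [this]

/-- Every column of the resonance matrix is the vector of leading coefficients of a solution of
the linearized system: the columns come from the derivatives with respect to `t₀` (up to sign),
where the exponent is `-1`, and to the `r_m`, where it is the resonance. -/
lemma exists_solution_of_column (B : Balance S) {p : ℂ × (Fin B.q → ℂ)} (hp : p ∈ B.Ω)
    (m : Fin (B.q + 1)) : ∃ (μ : ℤ) (φ : Fin n → PowerSeries ℂ),
      (∀ i, constantCoeff (φ i) = B.resonanceMatrix p i m) ∧
      ∀ i, LaurentSeries.derivative ℂ (HahnSeries.single (μ - B.k i) (1 : ℂ) *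
          HahnSeries.ofPowerSeries ℤ ℂ (φ i)) =
        ∑ j, jacobianLaurent (S.f i) p.1 (B.series p) j *
          (HahnSeries.single (μ - B.k j) (1 : ℂ) * HahnSeries.ofPowerSeries ℤ ℂ (φ j)) := by
  refine Fin.cases ?_ (fun m => ?_) m
  · refine ⟨-1, fun i => C ((-B.k i : ℤ) : ℂ) * PowerSeries.mk (fun j => B.a i j p) +
      eulerD (PowerSeries.mk fun j => B.a i j p) -
      X * PowerSeries.mk (fun j => fderiv ℂ (B.a i j) p (1, 0)), fun i => ?_, ?_⟩
    · have : constantCoeff (eulerD (PowerSeries.mk fun j => B.a i j p)) = 0 := by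
        rw [← coeff_zero_eq_constantCoeff_apply, coeff_eulerD]
        simp
      rw [map_sub, map_add, this]
      simp [resonanceMatrix]
    · have hcol : ∀ i, HahnSeries.single (-1 - B.k i) (1 : ℂ) * HahnSeries.ofPowerSeries ℤ ℂ
          (C ((-B.k i : ℤ) : ℂ) * PowerSeries.mk (fun j => B.a i j p) +
            eulerD (PowerSeries.mk fun j => B.a i j p) -
            X * PowerSeries.mk (fun j => fderiv ℂ (B.a i j) p (1, 0))) =
          -B.variation p (1, 0) i := by
        intro i
        have h1 := laurentDerivative_single_mul (-B.k i) (PowerSeries.mk fun j => B.a i j p)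
        rw [map_sub, mul_sub, map_mul _ X, HahnSeries.ofPowerSeries_X, ← mul_assoc,
          HahnSeries.single_mul_single, mul_one, variation, series, laurentOf, laurentOf, h1,
          show -1 - B.k i + 1 = -B.k i by ring, show -B.k i - 1 = -1 - B.k i by ring]
        simp
      intro i
      simp only [hcol, map_neg, B.derivative_variation hp, ← sum_neg_distrib]
      exact sum_congr rfl fun j _ => by ring
  · refine ⟨B.res m, fun i => PowerSeries.mk fun j =>
      fderiv ℂ (B.a i (j + B.res m)) p (0, Pi.single m 1), fun i => ?_, ?_⟩
    · simp [resonanceMatrix]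
    · have hcol : ∀ i, HahnSeries.single ((B.res m : ℤ) - B.k i) (1 : ℂ) *
          HahnSeries.ofPowerSeries ℤ ℂ (PowerSeries.mk fun j =>
            fderiv ℂ (B.a i (j + B.res m)) p (0, Pi.single m 1)) =
          B.variation p (0, Pi.single m 1) i := by
        intro i
        rw [variation, map_zero, zero_mul, sub_zero]
        ext e
        rw [coeff_single_mul_ofPowerSeries, coeff_laurentOf, coeff_mk]
        by_cases h1 : 0 ≤ e - (B.res m - B.k i)
        · rw [if_pos h1, if_pos (by lia),
            show (e - (B.res m - B.k i)).toNat + B.res m = (e + B.k i).toNat by lia]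
        · rw [if_neg h1]
          split_ifs with h2
          · exact (B.fderiv_eq_zero_of_lt hp i (by lia)).symm
          · rfl
      intro i
      simp only [hcol, B.derivative_variation hp]

/-- For a principal balance the linearized system has at most a simple pole in the variables
`z^(kᵢ) uᵢ`. -/
lemma IsPrincipal.exists_simple_pole {B : Balance S} (hB : B.IsPrincipal)
    {p : ℂ × (Fin B.q → ℂ)} (hp : p ∈ B.Ω) :
    ∃ G : Matrix (Fin n) (Fin n) (PowerSeries ℂ), ∀ i j,
      HahnSeries.single (B.k i - B.k j + 1) (1 : ℂ) *
        jacobianLaurent (S.f i) p.1 (B.series p) j = HahnSeries.ofPowerSeries ℤ ℂ (G i j) := by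
  obtain ⟨h, hR⟩ := hB
  choose μ φ hφ hsol using B.exists_solution_of_column hp
  refine exists_simple_pole_of_fundamental (μ := fun m => μ (Fin.cast h.symm m))
    (A := Matrix.of fun i j => jacobianLaurent (S.f i) p.1 (B.series p) j)
    (M := Matrix.of fun i m => φ (Fin.cast h.symm m) i) ?_ fun i m => hsol _ i
  convert hR p hp using 1
  ext i m
  simp [hφ]

end Balance

/-! ### Reduction to power series -/

/-- Monomials are homogeneous under the weighted scaling `uⱼ = z^(-kⱼ) wⱼ`. -/
lemma aeval_ofPowerSeries_monomial {n : ℕ} (k : Fin n → ℤ) (w : Fin n → PowerSeries ℂ)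
    (m : Fin n →₀ ℕ) (a : ℂ) :
    MvPolynomial.aeval (fun j => HahnSeries.single (-k j) (1 : ℂ) *
        HahnSeries.ofPowerSeries ℤ ℂ (w j)) (MvPolynomial.monomial m a) =
      HahnSeries.single (-∑ j, k j * m j) (1 : ℂ) * HahnSeries.ofPowerSeries ℤ ℂ
        (MvPolynomial.aeval w (MvPolynomial.monomial m a)) := by
  have hs : ∀ s : Finset (Fin n), ∏ j ∈ s, HahnSeries.single (-k j) (1 : ℂ) ^ m j =
      HahnSeries.single (-∑ j ∈ s, k j * m j) (1 : ℂ) := by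
    intro s
    induction s using Finset.induction_on with
    | empty => simp
    | insert i s hi ih =>
      rw [prod_insert hi, sum_insert hi, ih, HahnSeries.single_pow, HahnSeries.single_mul_single,
        one_pow, mul_one]
      congr 2
      simp
      ring
  rw [MvPolynomial.aeval_monomial, MvPolynomial.aeval_monomial,
    Finsupp.prod_fintype _ _ (by simp), Finsupp.prod_fintype _ _ (by simp)]
  simp only [mul_pow, prod_mul_distrib, hs, map_mul, map_prod, map_pow]
  rw [HahnSeries.algebraMap_apply']
  ring

lemma aeval_ofPowerSeries_pderiv_monomial {n : ℕ} (k : Fin n → ℤ) (w : Fin n → PowerSeries ℂ)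
    (m : Fin n →₀ ℕ) (j : Fin n) :
    MvPolynomial.aeval (fun j => HahnSeries.single (-k j) (1 : ℂ) *
        HahnSeries.ofPowerSeries ℤ ℂ (w j))
        (MvPolynomial.pderiv j (MvPolynomial.monomial m (1 : ℂ))) =
      HahnSeries.single (k j - ∑ j, k j * m j) (1 : ℂ) * HahnSeries.ofPowerSeries ℤ ℂ
        (MvPolynomial.aeval w (MvPolynomial.pderiv j (MvPolynomial.monomial m (1 : ℂ)))) := by
  rw [MvPolynomial.pderiv_monomial]
  by_cases hm : m j = 0
  · simp [hm]
  · rw [aeval_ofPowerSeries_monomial]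
    have hsplit : m = (m - Finsupp.single j 1) + Finsupp.single j 1 := by
      rw [tsub_add_cancel_of_le]
      simpa [Nat.one_le_iff_ne_zero] using hm
    have hsum : ∑ l, k l * (m l : ℤ) =
        ∑ l, k l * (((m - Finsupp.single j 1 : Fin n →₀ ℕ) l : ℕ) : ℤ) + k j := by
      conv_lhs => rw [hsplit]
      simp only [Finsupp.add_apply, Nat.cast_add, mul_add, sum_add_distrib]
      congr 1
      rw [sum_eq_single j]
      · simp
      · intro l _ hl
        simp [hl]
      · simp
    rw [hsum, sub_add_cancel_right]

/-- A formal Laurent series solution converges if the linearized system along it has at most a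
simple pole in the variables `wᵢ = z^(kᵢ) uᵢ`. After multiplication by a power `z^c`
the system becomes one for the power series `wᵢ` with convergent coefficients. -/
theorem isConvergent_of_simple_pole {n : ℕ} (S : RegularODE n) {t₀ : ℂ} (ht₀ : t₀ ∈ S.T)
    (k : Fin n → ℤ) (a : Fin n → ℕ → ℂ)
    (hsol : S.IsFormalSolution t₀ fun i => laurentOf (k i) (a i))
    (hlin : ∃ G : Matrix (Fin n) (Fin n) (PowerSeries ℂ), ∀ i j,
      HahnSeries.single (k i - k j + 1) (1 : ℂ) *
        jacobianLaurent (S.f i) t₀ (fun i => laurentOf (k i) (a i)) j =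
        HahnSeries.ofPowerSeries ℤ ℂ (G i j)) (i : Fin n) :
    IsConvergent (PowerSeries.mk (a i)) := by
  obtain ⟨G, hG⟩ := hlin
  -- `z^c` clears the poles of all monomials of `z^(kᵢ + 1) fᵢ(t₀ + z, z^(-k) w)`.
  obtain ⟨c, hc⟩ : ∃ c : ℕ, ∀ i, ∀ m ∈ (S.f i).support,
      0 ≤ c + k i + 1 - ∑ j, k j * m j := by
    refine ⟨∑ i, ∑ m ∈ (S.f i).support, (k i + 1 - ∑ j, k j * m j).natAbs, fun i m hm => ?_⟩
    have h1 := single_le_sum (f := fun m : Fin n →₀ ℕ => (k i + 1 - ∑ j, k j * m j).natAbs)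
      (fun _ _ => Nat.zero_le _) hm
    have h2 := single_le_sum (f := fun i => ∑ m ∈ (S.f i).support,
      (k i + 1 - ∑ j, k j * m j).natAbs) (fun _ _ => Nat.zero_le _) (mem_univ i)
    have h3 := h1.trans h2
    lia
  set w : Fin n → PowerSeries ℂ := fun i => PowerSeries.mk (a i) with hw
  set τ : Fin n → (Fin n →₀ ℕ) → convergentSeries := fun i m =>
    ⟨PowerSeries.mk fun l => iteratedDeriv l ((S.f i).coeff m) t₀ / (l.factorial : ℂ),
      isConvergent_taylor (S.analytic_coeff i m t₀ ht₀)⟩ with hτ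
  set x : convergentSeries := ⟨X, X_mem_convergentSeries⟩ with hx
  set e : Fin n → (Fin n →₀ ℕ) → ℕ := fun i m => (c + k i + 1 - ∑ j, k j * m j).toNat with he
  -- The right side `z^c (kᵢ wᵢ + z^(kᵢ + 1) fᵢ(t₀ + z, z^(-k) w))` of the system for `w`.
  set F : Fin n → MvPolynomial (Fin n) convergentSeries := fun i =>
    MvPolynomial.C (x ^ c * (k i : convergentSeries)) * MvPolynomial.X i +
      ∑ m ∈ (S.f i).support, MvPolynomial.C (x ^ e i m * τ i m) *
        MvPolynomial.map (algebraMap ℂ convergentSeries) (MvPolynomial.monomial m 1) with hF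
  have hxX : algebraMap convergentSeries (PowerSeries ℂ) x = X := rfl
  have hinj := HahnSeries.ofPowerSeries_injective (Γ := ℤ) (R := ℂ)
  have hcoef : ∀ i, ∀ m ∈ (S.f i).support, HahnSeries.ofPowerSeries ℤ ℂ
      (algebraMap convergentSeries (PowerSeries ℂ) (x ^ e i m * τ i m)) =
      HahnSeries.single (c + k i + 1 - ∑ j, k j * m j) (1 : ℂ) *
        taylorLaurent ((S.f i).coeff m) t₀ := by
    intro i m hm
    rw [map_mul, map_pow, hxX, map_mul, HahnSeries.ofPowerSeries_X_pow, he,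
      Int.toNat_of_nonneg (hc i m hm)]
    rfl
  have haeval : ∀ i, MvPolynomial.aeval w (F i) = X ^ c * C (k i : ℂ) * w i +
      ∑ m ∈ (S.f i).support, algebraMap convergentSeries (PowerSeries ℂ) (x ^ e i m * τ i m) *
        MvPolynomial.aeval w (MvPolynomial.monomial m (1 : ℂ)) := by
    intro i
    simp only [hF, map_add, map_sum, map_mul (MvPolynomial.aeval w), MvPolynomial.aeval_C,
      MvPolynomial.aeval_X, MvPolynomial.aeval_map_algebraMap]
    rw [map_mul _ (x ^ c), map_pow, hxX, map_intCast, map_intCast]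
  have hpderiv : ∀ i j, MvPolynomial.aeval w (MvPolynomial.pderiv j (F i)) =
      X ^ c * C (if i = j then (k i : ℂ) else 0) +
      ∑ m ∈ (S.f i).support, algebraMap convergentSeries (PowerSeries ℂ) (x ^ e i m * τ i m) *
        MvPolynomial.aeval w (MvPolynomial.pderiv j (MvPolynomial.monomial m (1 : ℂ))) := by
    intro i j
    simp only [hF, map_add, map_sum, MvPolynomial.pderiv_C_mul, MvPolynomial.pderiv_map,
      map_mul (MvPolynomial.aeval w), MvPolynomial.aeval_C, MvPolynomial.aeval_map_algebraMap]
    congr 1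
    rw [map_mul _ (x ^ c), map_pow, hxX, map_intCast, mul_assoc]
    split_ifs with hij
    · subst hij
      rw [MvPolynomial.pderiv_X_self, map_one, mul_one, map_intCast]
    · rw [MvPolynomial.pderiv_X_of_ne hij, map_zero, map_zero, mul_zero]
  refine isConvergent_of_regular_linearization (c := c) (F := F) (w := w) (fun i => ?_)
    (fun i j => ⟨C (if i = j then (k i : ℂ) else 0) + G i j, ?_⟩) i
  · have h := congrArg (fun H => HahnSeries.single (c + k i + 1 : ℤ) (1 : ℂ) * H) (hsol i)
    simp only [substLaurent, laurentOf, laurentDerivative_single_mul, ← aeval_monomial_one,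
      aeval_ofPowerSeries_monomial, mul_sum] at h
    rw [← mul_assoc, HahnSeries.single_mul_single, mul_one,
      show (c + k i + 1 : ℤ) + (-k i - 1) = c by ring, ← HahnSeries.ofPowerSeries_X_pow,
      ← map_mul] at h
    have h2 : ∑ m ∈ (S.f i).support, algebraMap convergentSeries (PowerSeries ℂ)
        (x ^ e i m * τ i m) * MvPolynomial.aeval w (MvPolynomial.monomial m (1 : ℂ)) =
        X ^ c * (C ((-k i : ℤ) : ℂ) * w i + eulerD (w i)) := by
      apply hinj
      rw [h, map_sum]
      refine sum_congr rfl fun m hm => ?_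
      rw [map_mul, hcoef i m hm, sub_eq_add_neg, ← one_mul (1 : ℂ),
        ← HahnSeries.single_mul_single, one_mul]
      ring
    rw [haeval, h2, Int.cast_neg, map_neg]
    ring
  · have h := congrArg (fun H => HahnSeries.single (c : ℤ) (1 : ℂ) * H) (hG i j)
    simp only [jacobianLaurent, laurentOf, aeval_ofPowerSeries_pderiv_monomial] at h
    rw [← mul_assoc, HahnSeries.single_mul_single, mul_one, mul_sum,
      ← HahnSeries.ofPowerSeries_X_pow, ← map_mul] at h
    rw [hpderiv, mul_add]
    congr 1
    apply hinj
    rw [← h, map_sum]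
    refine sum_congr rfl fun m hm => ?_
    rw [map_mul, hcoef i m hm, show (c + k i + 1 - ∑ j, k j * m j : ℤ) =
      (c + (k i - k j + 1)) + (k j - ∑ j, k j * m j) by ring, ← one_mul (1 : ℂ),
      ← HahnSeries.single_mul_single, one_mul]
    ring

theorem mainTheorem2 {n : ℕ} (S : RegularODE n) (hS : S.PassesPainleveTest) :
    ∀ B : Balance S, B.IsPrincipal → ∀ p ∈ B.Ω, B.ConvergesAt p := by
  intro B hB p hp
  have hconv := isConvergent_of_simple_pole S (B.mem_T p hp) B.k (fun i j => B.a i j p)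
    (B.solution p hp) (hB.exists_simple_pole hp)
  obtain ⟨ρ, hs, hρ⟩ := ((eventually_all.2 fun i => (hconv i).summable).and
    self_mem_nhdsWithin).exists
  refine ⟨ρ, hρ, fun t h0 hlt i => ?_⟩
  have hne : t - p.1 ≠ 0 := norm_pos_iff.1 h0
  have h1 : Summable fun j : ℕ => B.a i j p * (t - p.1) ^ j := by
    refine Summable.of_norm_bounded (hs i) fun j => ?_
    rw [norm_mul, norm_pow, coeff_mk]
    gcongr
  refine (h1.mul_right ((t - p.1) ^ (-B.k i))).congr fun j => ?_
  rw [sub_eq_add_neg (j : ℤ), zpow_add₀ hne, zpow_natCast, mul_assoc]
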